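/- Let $\Phi$ be an irreducible crystallographic root system spanning a finite-dimensional real vector space $V$, let $r=\dim_{\mathbb R} V$ be its rank, and let $W$ be its Weyl group, acting on $V$. The $2$-rank $r_2$ of $W$ is the integer such that the maximal order of an elementary Abelian $2$-subgroup of $W$ is $2^{r_2}$. Two roots $\alpha,\beta\in\Phi$ are called strongly orthogonal if $\alpha\neq\pm\beta$ and neither $\alpha+\beta$ nor $\alpha-\beta$ is a root; a set of roots is called strongly orthogonal if any two distinct members of it are strongly orthogonal. Then $r_2$ is equal to the maximal cardinality of a strongly orthogonal set of roots in $\Phi$. Moreover, $r_2=r$ if and only if $-1\in W$, i.e. if and only if some element of $W$ acts on $V$ as $v\mapsto -v$. -/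

import Mathlib

/-- `H` is an elementary Abelian `2`-subgroup: it is commutative and all its elements square to `1`. -/
def IsElementaryAbelianTwo {G : Type*} [Group G] (H : Subgroup G) : Prop :=
  (∀ x ∈ H, ∀ y ∈ H, x * y = y * x) ∧ ∀ x ∈ H, x ^ 2 = 1

/-- The (finite) group `G` has `2`-rank `n`: the maximal order of an elementary Abelian
`2`-subgroup of `G` is `2 ^ n`. -/
def HasTwoRank (G : Type*) [Group G] (n : ℕ) : Prop :=
  IsGreatest {m : ℕ | ∃ H : Subgroup G, IsElementaryAbelianTwo H ∧ Nat.card H = m} (2 ^ n)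

/-- Two roots `α`, `β` are strongly orthogonal if `α ≠ ± β` (neither `α + β` nor `α - β` is zero) and
neither `α + β` nor `α - β` is a root. -/
def RootPairing.IsStronglyOrthogonal {ι R M N : Type*} [CommRing R] [AddCommGroup M] [Module R M]
    [AddCommGroup N] [Module R N] (P : RootPairing ι R M N) (i j : ι) : Prop :=
  (P.root i ≠ P.root j ∧ P.root i ≠ -P.root j) ∧
    P.root i + P.root j ∉ Set.range P.root ∧ P.root i - P.root j ∉ Set.range P.root

/-- A finite set of roots (given by their indices) that are pairwise strongly orthogonal. -/
def RootPairing.IsStronglyOrthogonalSet {ι R M N : Type*} [CommRing R] [AddCommGroup M] [Module R M]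
    [AddCommGroup N] [Module R N] (P : RootPairing ι R M N) (S : Finset ι) : Prop :=
  ∀ i ∈ S, ∀ j ∈ S, i ≠ j → P.IsStronglyOrthogonal i j

/-! Both numbers equal the largest dimension of the `-1`-eigenspace of an element `w` with `w² = 1`.
Simultaneous diagonalisation bounds the rank of an elementary Abelian 2-subgroup by such a dimension
(`exists_card_le_two_pow_finrank_eigenspace`). Conversely, that eigenspace contains as many strongly
orthogonal roots as its dimension (`exists_isStronglyOrthogonalSet_card_eq`): split off a longest
root negated by `w`, replace `w` by its product with that reflection, and repeat. Such a root exists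
because the Weyl group acts freely on chambers (`exists_smul_root_eq_neg`). The reflections in
strongly orthogonal roots commute and are independent, which closes the circle. The rank is attained
exactly when the eigenspace is all of `V`, that is, when `w = -1`. -/

namespace RootPairing

open Module Set Function IsAddIndecomposable

variable {ι V N : Type*} [AddCommGroup V] [Module ℝ V] [AddCommGroup N] [Module ℝ N]
  (P : RootPairing ι ℝ V N)

/-! ### Reflections and the invariant form. -/

lemma weylGroup_ext {w w' : P.weylGroup} (h : ∀ v : V, w • v = w' • v) : w = w' := by
  refine Subtype.ext (Equiv.weightHom_injective P ?_)
  ext v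
  exact h v

lemma weylGroup_ext_root [P.IsRootSystem] {w w' : P.weylGroup}
    (h : ∀ i, w • P.root i = w' • P.root i) : w = w' := by
  refine Subtype.ext (Equiv.weightHom_injective P (LinearEquiv.toLinearMap_injective ?_))
  refine LinearMap.ext_on_range (v := P.root) IsRootSystem.span_root_eq_top fun i ↦ h i

/-- The Weyl group acting on the weight space by linear maps. -/
noncomputable def weylGroupToEnd : P.weylGroup →* Module.End ℝ V where
  toFun w := ((Equiv.weightHom P w : V ≃ₗ[ℝ] V) : V →ₗ[ℝ] V)
  map_one' := rfl
  map_mul' _ _ := rfl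

@[simp] lemma weylGroupToEnd_apply (w : P.weylGroup) (v : V) : P.weylGroupToEnd w v = w • v := rfl

@[simp] lemma weylGroup_smul_smul (w : P.weylGroup) (c : ℝ) (v : V) : w • c • v = c • w • v :=
  map_smul (P.weylGroupToEnd w) c v

lemma ofIdx_smul_eq (i : ι) (v : V) :
    weylGroup.ofIdx P i • v = v - P.coroot' i v • P.root i := rfl

@[simp] lemma ofIdx_mul_self (i : ι) : weylGroup.ofIdx P i * weylGroup.ofIdx P i = 1 :=
  P.weylGroup_ext fun v ↦ by
    rw [mul_smul, one_smul]
    exact P.reflection_same i v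

lemma rootForm_mul_coroot' [Fintype ι] (i : ι) (v : V) :
    P.RootForm (P.root i) (P.root i) * P.coroot' i v = 2 * P.RootForm (P.root i) v := by
  have := congrArg (P.toLinearMap v) (P.rootForm_self_smul_coroot i)
  rwa [map_smul, map_nsmul, toLinearMap_apply_apply_Polarization, smul_eq_mul, nsmul_eq_mul,
    Nat.cast_ofNat] at this

lemma rootForm_smul_smul [Fintype ι] (w : P.weylGroup) (x y : V) :
    P.RootForm (w • x) (w • y) = P.RootForm x y :=
  InvariantForm.apply_weylGroup_smul P (B := P.toInvariantForm) w x y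

lemma rootForm_comm [Fintype ι] (x y : V) : P.RootForm x y = P.RootForm y x :=
  P.rootForm_symmetric.eq x y

lemma rootForm_pos [Fintype ι] [P.IsRootSystem] {x : V} (hx : x ≠ 0) : 0 < P.RootForm x x :=
  P.rootForm_pos_of_ne_zero (by simp) hx

/-- Needed because the system may be non-reduced: `α`, `-α` and `2α` can be distinct roots with one
reflection. -/
lemma ofIdx_eq_of_root_eq_smul [Finite ι] [P.IsRootSystem] {i j : ι} {c : ℝ} (h : P.root i = c • P.root j) :
    weylGroup.ofIdx P i = weylGroup.ofIdx P j := by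
  have := Fintype.ofFinite ι
  refine P.weylGroup_ext fun v ↦ ?_
  have h1 := P.rootForm_mul_coroot' i v
  have h2 := P.rootForm_mul_coroot' j v
  have h3 := P.rootForm_pos (P.ne_zero j)
  have hc : c ≠ 0 := by rintro rfl; exact P.ne_zero i (by simpa using h)
  simp only [h, map_smul, LinearMap.smul_apply, smul_eq_mul] at h1
  have h4 : c * P.coroot' i v = P.coroot' j v := by
    have : (P.RootForm (P.root j) (P.root j) * c) * (c * P.coroot' i v - P.coroot' j v) = 0 := by
      linear_combination h1 - c * h2
    rcases mul_eq_zero.mp this with h | h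
    · exact absurd h (mul_ne_zero h3.ne' hc)
    · linarith
  rw [ofIdx_smul_eq, ofIdx_smul_eq, h, smul_smul, ← h4, mul_comm]

lemma mul_ofIdx_mul_inv [Finite ι] [P.IsRootSystem] (w : P.weylGroup) {i k : ι}
    (h : w • P.root i = P.root k) : w * weylGroup.ofIdx P i * w⁻¹ = weylGroup.ofIdx P k := by
  have := Fintype.ofFinite ι
  refine P.weylGroup_ext fun v ↦ ?_
  have h1 := P.rootForm_mul_coroot' i (w⁻¹ • v)
  have h2 := P.rootForm_mul_coroot' k v
  rw [← P.rootForm_smul_smul w, ← P.rootForm_smul_smul w (P.root i) (w⁻¹ • v), h, smul_inv_smul,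
    ← h2] at h1
  have h3 := mul_left_cancel₀ (P.rootForm_pos (P.ne_zero k)).ne' h1
  rw [mul_smul, mul_smul, ofIdx_smul_eq, ofIdx_smul_eq, smul_sub, weylGroup_smul_smul, h,
    smul_inv_smul, h3]

lemma exists_smul_eq_of_not_linearIndependent {i j : ι}
    (h : ¬ LinearIndependent ℝ ![P.root i, P.root j]) : ∃ c : ℝ, P.root j = c • P.root i := by
  rw [LinearIndependent.pair_iff' (P.ne_zero i)] at h
  push Not at h
  exact h.imp fun _ ↦ Eq.symm

/-! ### Simple reflections, the exchange condition and free action on chambers. -/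

section Chamber

/-- Walk down the root string from `root j` to its reflection. At a first sign change, two
consecutive members differ by the simple root `root i`, which would then be a sum of two positive
roots. -/
lemma apply_reflection_pos_of_mem_baseOf [Finite ι] [P.IsCrystallographic] (f : V →ₗ[ℝ] ℝ)
    (hf : ∀ i, f (P.root i) ≠ 0) {i j : ι}
    (hi : i ∈ baseOf P.root (f : V →+ ℝ)) (hj : 0 < f (P.root j))
    (hij : LinearIndependent ℝ ![P.root i, P.root j]) :
    0 < f (P.reflection i (P.root j)) := by
  obtain ⟨hi0, hi⟩ := hi
  simp only [mem_ofPred_eq, AddMonoidHom.coe_coe] at hi0 hi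
  have key : ∀ n : ℕ, (n : ℤ) ≤ P.pairingIn ℤ j i → 0 < f (P.root j - (n : ℤ) • P.root i) := by
    intro n
    induction n with
    | zero => intro _; simpa using hj
    | succ n ih =>
      intro hn
      have hn0 : (n : ℤ) ≤ P.pairingIn ℤ j i := by push_cast at hn; omega
      have hend : P.root j - P.pairingIn ℤ j i • P.root i ∈ range P.root :=
        ⟨P.reflectionPerm i j, by
          rw [root_reflectionPerm, reflection_apply_root, ← P.algebraMap_pairingIn ℤ,
            algebraMap_int_eq, eq_intCast, Int.cast_smul_eq_zsmul]⟩
      have mem (m : ℕ) (hm : (m : ℤ) ≤ P.pairingIn ℤ j i) :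
          P.root j - (m : ℤ) • P.root i ∈ range P.root := by
        rw [P.root_sub_zsmul_mem_range_iff hij] at hend ⊢
        exact ⟨by omega, hm.trans hend.2⟩
      obtain ⟨k, hk⟩ := mem n hn0
      obtain ⟨l, hl⟩ := mem (n + 1) hn
      by_contra hneg
      have hl' : f (P.root l) < 0 := lt_of_le_of_ne (by rw [hl]; exact not_lt.mp hneg) (hf l)
      have := hi k (by rw [hk]; exact ih hn0) (P.reflectionPerm l l) (by simpa using hl')
        (by rw [root_reflectionPerm, reflection_apply_self, hk, hl]; push_cast; module)
      simp [P.ne_zero] at this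
  rw [reflection_apply_root, ← P.algebraMap_pairingIn ℤ]
  rcases le_or_gt 0 (P.pairingIn ℤ j i) with h | h
  · have := key (P.pairingIn ℤ j i).toNat (by omega)
    rwa [Int.toNat_of_nonneg h, ← Int.cast_smul_eq_zsmul ℝ] at this
  · have : ((P.pairingIn ℤ j i : ℤ) : ℝ) * f (P.root i) < 0 :=
      mul_neg_of_neg_of_pos (by exact_mod_cast h) hi0
    simp
    linarith

variable [Finite ι] [P.IsRootSystem] (f : V →ₗ[ℝ] ℝ)

/-- A positive root is a sum of simple roots; were all these pairings nonpositive, its squared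
length would be too. -/
lemma exists_mem_baseOf_pairing_pos {j : ι} (hj : 0 < f (P.root j)) :
    ∃ i ∈ baseOf P.root (f : V →+ ℝ), 0 < P.pairing j i := by
  have := Fintype.ofFinite ι
  by_contra! hcon
  have hmem : P.root j ∈ AddSubmonoid.closure (P.root '' baseOf P.root (f : V →+ ℝ)) := by
    rw [AddSubmonoid.closure_image_isAddIndecomposable_baseOf]
    exact AddSubmonoid.subset_closure ⟨j, hj, rfl⟩
  have hle : P.RootForm (P.root j) (P.root j) ≤ 0 := by
    refine AddSubmonoid.closure_induction (motive := fun x _ ↦ P.RootForm (P.root j) x ≤ 0) ?_ ?_ ?_ hmem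
    · rintro - ⟨i, hi, rfl⟩
      have h1 := P.rootForm_mul_coroot' i (P.root j)
      have h2 := mul_nonpos_of_nonneg_of_nonpos (P.rootForm_pos (P.ne_zero i)).le (hcon i hi)
      rw [root_coroot'_eq_pairing] at h1
      linarith [P.rootForm_comm (P.root i) (P.root j)]
    · simp
    · intro x y _ _ hx hy
      rw [map_add]
      linarith
  exact hle.not_gt (P.rootForm_pos (P.ne_zero j))

variable [P.IsCrystallographic]

lemma ofIdx_eq_of_mem_baseOf (hf : ∀ i, f (P.root i) ≠ 0) {i j : ι}
    (hi : i ∈ baseOf P.root (f : V →+ ℝ)) (hj : 0 < f (P.root j))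
    (h : f (P.reflection i (P.root j)) < 0) : weylGroup.ofIdx P j = weylGroup.ofIdx P i := by
  by_cases hij : LinearIndependent ℝ ![P.root i, P.root j]
  · exact absurd h (P.apply_reflection_pos_of_mem_baseOf f hf hi hj hij).not_gt
  · obtain ⟨c, hc⟩ := P.exists_smul_eq_of_not_linearIndependent hij
    exact P.ofIdx_eq_of_root_eq_smul hc

lemma ofIdx_mem_closure_baseOf (hf : ∀ i, f (P.root i) ≠ 0) (j : ι) :
    weylGroup.ofIdx P j ∈
      Subgroup.closure (weylGroup.ofIdx P '' baseOf P.root (f : V →+ ℝ)) := by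
  set G := Subgroup.closure (weylGroup.ofIdx P '' baseOf P.root (f : V →+ ℝ)) with hG
  have pos : ∀ j, 0 < f (P.root j) → weylGroup.ofIdx P j ∈ G := by
    by_contra! hcon
    -- A counterexample of least height `f`: a simple reflection either lowers it to a positive root
    -- whose reflection is in `G`, or is itself the reflection in it.
    obtain ⟨j, hj⟩ := (Set.toFinite {j | 0 < f (P.root j) ∧ weylGroup.ofIdx P j ∉ G}).exists_minimalFor
      (f ∘ P.root) _ hcon
    obtain ⟨hj0, hjG⟩ := hj.prop
    obtain ⟨i, hi, hij⟩ := P.exists_mem_baseOf_pairing_pos f hj0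
    have hiG : weylGroup.ofIdx P i ∈ G := Subgroup.subset_closure ⟨i, hi, rfl⟩
    have hi0 : 0 < f (P.root i) := hi.1
    rcases lt_or_gt_of_ne (hf (P.reflectionPerm i j)) with h | h
    · rw [root_reflectionPerm] at h
      exact hjG (P.ofIdx_eq_of_mem_baseOf f hf hi hj0 h ▸ hiG)
    · have hlt : f (P.root (P.reflectionPerm i j)) < f (P.root j) := by
        rw [root_reflectionPerm, reflection_apply_root, map_sub, map_smul, smul_eq_mul]
        linarith [mul_pos hij hi0]
      have hk : weylGroup.ofIdx P (P.reflectionPerm i j) ∈ G := by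
        by_contra hk
        exact hlt.not_ge (hj.le_of_le ⟨h, hk⟩ hlt.le)
      have hconj := P.mul_ofIdx_mul_inv (weylGroup.ofIdx P i) (i := P.reflectionPerm i j) (k := j)
        (by rw [root_reflectionPerm]; exact P.reflection_same i _)
      exact hjG (hconj ▸ mul_mem (mul_mem hiG hk) (inv_mem hiG))
  rcases lt_or_gt_of_ne (hf j) with h | h
  · have h1 : weylGroup.ofIdx P j = weylGroup.ofIdx P (P.reflectionPerm j j) :=
      P.ofIdx_eq_of_root_eq_smul (c := -1) (by simp)
    rw [h1]
    exact pos _ (by simpa using h)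
  · exact pos j h

lemma exists_list_baseOf_prod_eq (hf : ∀ i, f (P.root i) ≠ 0) (w : P.weylGroup) :
    ∃ l : List ι, (∀ i ∈ l, i ∈ baseOf P.root (f : V →+ ℝ)) ∧
      (l.map (weylGroup.ofIdx P)).prod = w := by
  have hw : w ∈ Subgroup.closure (weylGroup.ofIdx P '' baseOf P.root (f : V →+ ℝ)) := by
    obtain ⟨w, hw⟩ := w
    induction hw using weylGroup.induction with
    | mem i => exact P.ofIdx_mem_closure_baseOf f hf i
    | one => exact one_mem _
    | mul x y hx hy hx' hy' => exact mul_mem hx' hy'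
  induction hw using Subgroup.closure_induction'' with
  | one => exact ⟨[], by simp⟩
  | mem _ h =>
    obtain ⟨i, hi, rfl⟩ := h
    exact ⟨[i], by simpa using hi⟩
  | inv_mem _ h =>
    obtain ⟨i, hi, rfl⟩ := h
    exact ⟨[i], by simpa using hi, by simp [eq_inv_iff_mul_eq_one]⟩
  | mul x y hx hy hx' hy' =>
    obtain ⟨l, hl, rfl⟩ := hx'
    obtain ⟨m, hm, rfl⟩ := hy'
    exact ⟨l ++ m, by simp only [List.mem_append]; grind, by simp⟩

/-- The exchange condition. -/
lemma exists_list_prod_mul_ofIdx_eq (hf : ∀ i, f (P.root i) ≠ 0) (l : List ι) {i : ι}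
    (hl : ∀ i ∈ l, i ∈ baseOf P.root (f : V →+ ℝ)) (hi : 0 < f (P.root i))
    (h : f ((l.map (weylGroup.ofIdx P)).prod • P.root i) < 0) :
    ∃ m : List ι, (∀ i ∈ m, i ∈ baseOf P.root (f : V →+ ℝ)) ∧ m.length + 1 = l.length ∧
      (m.map (weylGroup.ofIdx P)).prod =
        (l.map (weylGroup.ofIdx P)).prod * weylGroup.ofIdx P i := by
  induction l with
  | nil => simp at h; linarith
  | cons j l ih =>
    simp only [List.mem_cons, forall_eq_or_imp] at hl
    set w := (l.map (weylGroup.ofIdx P)).prod with hw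
    obtain ⟨k, hk⟩ : ∃ k, w • P.root i = P.root k := ⟨_, P.weylGroup_apply_root w i⟩
    rcases lt_or_gt_of_ne (hf k) with hneg | hpos
    · obtain ⟨m, hm, hlen, hprod⟩ := ih hl.2 (by rwa [hk])
      exact ⟨j :: m, by simpa using ⟨hl.1, hm⟩, by simp [← hlen], by simp [hprod, mul_assoc, ← hw]⟩
    -- The letter `j` makes the sign change, so its reflection is the conjugate by `w` of that in
    -- `i`; deleting `j` amounts to multiplying by the latter on the right.
    · refine ⟨l, hl.2, by simp, ?_⟩
      rw [List.map_cons, List.prod_cons, mul_smul, ← hw, hk] at h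
      have h1 := P.ofIdx_eq_of_mem_baseOf f hf hl.1 hpos h
      rw [← P.mul_ofIdx_mul_inv w hk] at h1
      rw [List.map_cons, List.prod_cons, ← hw, ← h1]
      simp [mul_assoc]

/-- The Weyl group acts freely on the chambers. -/
lemma eq_one_of_forall_apply_smul_pos (hf : ∀ i, f (P.root i) ≠ 0) {w : P.weylGroup}
    (hw : ∀ i, 0 < f (P.root i) → 0 < f (w • P.root i)) : w = 1 := by
  obtain ⟨l, hl, rfl⟩ := P.exists_list_baseOf_prod_eq f hf w
  induction hn : l.length using Nat.strong_induction_on generalizing l with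
  | _ n ih =>
    rcases List.eq_nil_or_concat l with rfl | ⟨l, i, rfl⟩
    · simp
    · simp only [List.concat_eq_append, List.mem_append, List.mem_singleton, List.map_append,
        List.map_cons, List.map_nil, List.prod_append, List.prod_cons, List.prod_nil, mul_one,
        List.length_append, List.length_singleton] at *
      have hi : i ∈ baseOf P.root (f : V →+ ℝ) := hl i (.inr rfl)
      have hi0 : 0 < f (P.root i) := hi.1
      -- The full word keeps `root i` positive, so the word without its last letter `i` makes it
      -- negative, and exchange shortens the word by two.
      have hneg : f ((l.map (weylGroup.ofIdx P)).prod • P.root i) < 0 := by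
        have := hw i hi0
        rw [mul_smul, weylGroup.ofIdx_smul, Equiv.reflection_smul, reflection_apply_self, smul_neg,
          map_neg] at this
        linarith
      obtain ⟨m, hm, hlen, hprod⟩ :=
        P.exists_list_prod_mul_ofIdx_eq f hf l (fun j hj ↦ hl j (.inl hj)) hi0 hneg
      rw [← hprod]
      exact ih m.length (by omega) m hm (by rwa [hprod]) rfl

end Chamber

/-- An involution in the Weyl group negates some root. -/
lemma exists_smul_root_eq_neg [Finite ι] [P.IsRootSystem] [P.IsCrystallographic] {w : P.weylGroup}
    (hw : w * w = 1) (hne : w ≠ 1) : ∃ i, w • P.root i = -P.root i := by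
  by_contra! hcon
  -- Averaging a generic `g` over `w` gives a `w`-invariant `f` vanishing on no root, so `w` fixes a
  -- chamber.
  obtain ⟨g, hg⟩ := exists_dual_forall_apply_ne_zero (K := ℝ) (fun i ↦ P.root i + w • P.root i)
    fun i h ↦ hcon i (by rwa [add_comm, add_eq_zero_iff_eq_neg] at h)
  have hsq (v : V) : w • w • v = v := by rw [smul_smul, hw, one_smul]
  let f : V →ₗ[ℝ] ℝ := g + g ∘ₗ P.weylGroupToEnd w
  have hf (v : V) : f v = g (v + w • v) := by simp [f]
  refine hne (P.eq_one_of_forall_apply_smul_pos f (fun i ↦ by rw [hf]; exact hg i) fun i hi ↦ ?_)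
  rwa [hf, hsq, add_comm, ← hf]

end RootPairing

/-! ### Sign characters and linear elementary Abelian 2-groups. -/

lemma eq_zero_of_neg_eq_self {V : Type*} [AddCommGroup V] [Module ℝ V] {v : V} (h : -v = v) :
    v = 0 := by
  have h2 : (2 : ℝ) • v = 0 := by
    rw [two_smul]
    nth_rw 1 [← h]
    exact neg_add_cancel v
  exact (smul_eq_zero.mp h2).resolve_left two_ne_zero

/-- A finite group with a jointly injective finite family of sign characters has an independent
subfamily that realises every sign pattern and determines the size of the group. -/
lemma exists_subset_card_le_two_pow_and_forall_exists_eq {J : Type*} [DecidableEq J] (T₀ : Finset J)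
    {G : Type*} [Group G] [Finite G] (χ : J → G →* ℤˣ)
    (h : ∀ g, (∀ j ∈ T₀, χ j g = 1) → g = 1) :
    ∃ T ⊆ T₀, Nat.card G ≤ 2 ^ T.card ∧ ∀ s : J → ℤˣ, ∃ g, ∀ j ∈ T, χ j g = s j := by
  induction T₀ using Finset.induction_on generalizing G with
  | empty =>
    have : Subsingleton G := ⟨fun x y ↦ (h x (by simp)).trans (h y (by simp)).symm⟩
    exact ⟨∅, le_rfl, by simp [Nat.card_unique], fun _ ↦ ⟨1, by simp⟩⟩
  | insert a T₀ ha ih =>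
    by_cases htriv : ∀ g, χ a g = 1
    · obtain ⟨T, hT, h1, h2⟩ := ih χ fun g hg ↦ h g (by simpa [htriv] using hg)
      exact ⟨T, hT.trans (Finset.subset_insert _ _), h1, h2⟩
    · push Not at htriv
      obtain ⟨g₀, hg₀⟩ := htriv
      replace hg₀ : χ a g₀ = -1 := (Int.units_eq_one_or _).resolve_left hg₀
      -- The kernel has index at most two, and its elements adjust the other signs without changing
      -- `χ a`.
      obtain ⟨T, hT, h1, h2⟩ := ih (G := (χ a).ker) (fun j ↦ (χ j).comp (χ a).ker.subtype)
        fun g hg ↦ Subtype.ext (h g (by simpa [(MonoidHom.mem_ker).mp g.2] using hg))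
      have haT : a ∉ T := fun h ↦ ha (hT h)
      refine ⟨insert a T, Finset.insert_subset_insert _ hT, ?_, fun s ↦ ?_⟩
      · have hcard := (χ a).ker.card_mul_index
        rw [Subgroup.index_ker] at hcard
        have hle : Nat.card (χ a).range ≤ 2 := by
          simpa using Nat.card_le_card_of_injective (χ a).range.subtype Subtype.val_injective
        rw [← hcard, Finset.card_insert_of_notMem haT, pow_succ]
        exact Nat.mul_le_mul h1 hle
      · obtain ⟨g₁, hg₁⟩ : ∃ g₁, χ a g₁ = s a := by
          rcases Int.units_eq_one_or (s a) with h | h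
          · exact ⟨1, by simp [h]⟩
          · exact ⟨g₀, by rw [hg₀, h]⟩
        obtain ⟨g₂, hg₂⟩ := h2 fun j ↦ (χ j g₁)⁻¹ * s j
        refine ⟨g₁ * g₂, fun j hj ↦ ?_⟩
        rcases Finset.mem_insert.mp hj with rfl | hj
        · rw [map_mul, hg₁, MonoidHom.mem_ker.mp g₂.2, mul_one]
        · have := hg₂ j hj
          simp only [MonoidHom.comp_apply, Subgroup.subtype_apply] at this
          rw [map_mul, this, mul_inv_cancel_left]

namespace Module.End

variable {V : Type*} [AddCommGroup V] [Module ℝ V] {G : Type*} [Group G]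
  (ρ : G →* Module.End ℝ V)

/-- A simultaneous eigenvector of a group of involutions defines a sign character. -/
lemma exists_signCharacter_of_forall_apply_eq_or {v : V} (hv : v ≠ 0)
    (h : ∀ g, ρ g v = v ∨ ρ g v = -v) :
    ∃ χ : G →* ℤˣ, ∀ g, ρ g v = ((χ g : ℤ) : ℝ) • v := by
  classical
  have hne : -v ≠ v := fun h ↦ hv (eq_zero_of_neg_eq_self h)
  refine ⟨MonoidHom.mk' (fun g ↦ if ρ g v = v then 1 else -1) fun a b ↦ ?_, fun g ↦ ?_⟩
  · rcases h a with ha | ha <;> rcases h b with hb | hb <;> simp [ha, hb, hne]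
  · rcases h g with hg | hg <;> simp [hg, hne]

/-- Start from a nonzero `u - g u`; for each further `x` with `x v ≠ -v`, replace `v` by `v + x v`,
which `x` fixes. Commutativity preserves the earlier signs. -/
lemma exists_simultaneous_eigenvector [Finite G] (hcomm : ∀ x y : G, x * y = y * x)
    (hsq : ∀ x : G, x ^ 2 = 1) (hρ : Function.Injective ρ) {g : G} (hg : g ≠ 1) :
    ∃ v ≠ 0, ρ g v = -v ∧ ∀ x, ρ x v = v ∨ ρ x v = -v := by
  classical
  have := Fintype.ofFinite G
  have hsq' (x : G) (v : V) : ρ x (ρ x v) = v := by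
    rw [← Module.End.mul_apply, ← map_mul, ← sq, hsq, map_one, Module.End.one_apply]
  have hcomm' (x y : G) (v : V) : ρ x (ρ y v) = ρ y (ρ x v) := by
    rw [← Module.End.mul_apply, ← map_mul, hcomm, map_mul, Module.End.mul_apply]
  suffices ∀ s : Finset G, ∃ v ≠ 0, ρ g v = -v ∧ ∀ x ∈ s, ρ x v = v ∨ ρ x v = -v by
    simpa using this Finset.univ
  intro s
  induction s using Finset.induction_on with
  | empty =>
    obtain ⟨u, hu⟩ : ∃ u, ρ g u ≠ u := by
      by_contra! hcon
      exact hg (hρ (by rw [map_one]; ext u; exact hcon u))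
    exact ⟨u - ρ g u, fun h ↦ hu (sub_eq_zero.mp h).symm, by simp [hsq'], by simp⟩
  | insert a s ha ih =>
    obtain ⟨v, hv, hgv, hs⟩ := ih
    by_cases hav : ρ a v = -v
    · exact ⟨v, hv, hgv, by simpa using ⟨.inr hav, hs⟩⟩
    · refine ⟨v + ρ a v, fun h ↦ hav (eq_neg_of_add_eq_zero_right h), ?_, ?_⟩
      · rw [map_add, hcomm' g a, hgv, map_neg]
        abel
      · simp only [Finset.mem_insert, forall_eq_or_imp]
        refine ⟨.inl (by rw [map_add, hsq', add_comm]), fun x hx ↦ ?_⟩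
        rw [map_add, hcomm' x a]
        rcases hs x hx with h | h
        · exact .inl (by rw [h])
        · exact .inr (by rw [h, map_neg]; abel)

lemma iSupIndep_iInf_eigenspace_signCharacter (hcomm : ∀ x y : G, x * y = y * x) :
    iSupIndep fun χ : G →* ℤˣ ↦ ⨅ g, (ρ g).eigenspace ((χ g : ℤ) : ℝ) := by
  have h1 := independent_iInf_maxGenEigenspace_of_forall_mapsTo (fun g ↦ ρ g) fun i j φ ↦
    mapsTo_maxGenEigenspace_of_comm (by rw [Commute, SemiconjBy, ← map_mul, hcomm, map_mul]) φ
  have h2 := h1.comp (f := fun (χ : G →* ℤˣ) g ↦ ((χ g : ℤ) : ℝ)) fun χ ψ h ↦ by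
    ext g
    simpa using congrFun h g
  exact h2.mono fun χ ↦ iInf_mono fun g ↦ (genEigenspace (ρ g) _).monotone le_top

/-- A faithful linear elementary Abelian `2`-group contains an element whose `-1`-eigenspace has
dimension at least the rank of the group. -/
lemma exists_card_le_two_pow_finrank_eigenspace [Module.Finite ℝ V] [Finite G]
    (hcomm : ∀ x y : G, x * y = y * x) (hsq : ∀ x : G, x ^ 2 = 1) (hρ : Function.Injective ρ) :
    ∃ g, Nat.card G ≤ 2 ^ Module.finrank ℝ ((ρ g).eigenspace (-1)) := by
  classical
  have : Finite (G →* ℤˣ) := DFunLike.finite _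
  have := Fintype.ofFinite (G →* ℤˣ)
  let E (χ : G →* ℤˣ) : Submodule ℝ V := ⨅ g, (ρ g).eigenspace ((χ g : ℤ) : ℝ)
  have hE (χ : G →* ℤˣ) (v : V) : v ∈ E χ ↔ ∀ g, ρ g v = ((χ g : ℤ) : ℝ) • v := by
    simp [E]
  obtain ⟨T, hT, hcard, hsurj⟩ := exists_subset_card_le_two_pow_and_forall_exists_eq
    (Finset.univ.filter fun χ : G →* ℤˣ ↦ E χ ≠ ⊥) (fun χ ↦ χ) fun g hg ↦ by
      by_contra hne
      obtain ⟨v, hv, hgv, h⟩ := exists_simultaneous_eigenvector ρ hcomm hsq hρ hne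
      obtain ⟨χ, hχ⟩ := exists_signCharacter_of_forall_apply_eq_or ρ hv h
      have := hg χ (by simpa using (E χ).ne_bot_iff.mpr ⟨v, (hE χ v).mpr hχ, hv⟩)
      have h1 := hχ g
      rw [this, hgv] at h1
      exact hv (eq_zero_of_neg_eq_self (by simpa using h1))
  -- Every character in `T` is `-1` at `g`, so each contributes an independent vector to the
  -- `-1`-eigenspace of `g`.
  obtain ⟨g, hg⟩ := hsurj fun _ ↦ -1
  refine ⟨g, hcard.trans (Nat.pow_le_pow_right two_pos ?_)⟩
  have hex (χ : T) : ∃ v ∈ E χ, v ≠ 0 :=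
    (E χ).ne_bot_iff.mp (by simpa using hT χ.2)
  choose v hvE hv using hex
  have hli : LinearIndependent ℝ v :=
    ((iSupIndep_iInf_eigenspace_signCharacter ρ hcomm).comp
      Subtype.val_injective).linearIndependent _ hvE hv
  calc T.card = Module.finrank ℝ (Submodule.span ℝ (Set.range v)) := by
        simp [finrank_span_eq_card hli]
    _ ≤ _ := Submodule.finrank_mono <| Submodule.span_le.mpr <| by
        rintro - ⟨χ, rfl⟩
        have := (hE χ (v χ)).mp (hvE χ) g
        simpa [mem_eigenspace_iff, hg χ χ.2] using this

end Module.End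

/-! ### Strongly orthogonal roots and involutions of the Weyl group. -/

namespace RootPairing

open Module Set Function

variable {ι V N : Type*} [AddCommGroup V] [Module ℝ V] [AddCommGroup N] [Module ℝ N]
  (P : RootPairing ι ℝ V N)

lemma mem_eigenspace_weylGroupToEnd_neg_one {w : P.weylGroup} {v : V} :
    v ∈ (P.weylGroupToEnd w).eigenspace (-1) ↔ w • v = -v := by
  simp

variable {P} in
lemma IsStronglyOrthogonal.pairing_eq_zero [Finite ι] [P.IsCrystallographic] {i j : ι}
    (h : P.IsStronglyOrthogonal i j) : P.pairing i j = 0 :=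
  P.pairing_eq_zero_of_add_notMem_of_sub_notMem (fun hij ↦ h.1.1 (by rw [hij])) h.1.2 h.2.1 h.2.2

variable [Finite ι] [P.IsRootSystem]

lemma moduleFinite_weightSpace (P : RootPairing ι ℝ V N) [P.IsRootSystem] :  Module.Finite ℝ V :=
  Module.finite_def.mpr <|
    IsRootSystem.span_root_eq_top (P := P) ▸ Submodule.fg_span (finite_range _)

lemma finite_weylGroup : Finite P.weylGroup :=
  Finite.of_injective P.weylGroupToPerm fun w w' h ↦ P.weylGroup_ext_root fun i ↦ by
    rw [weylGroup_apply_root, weylGroup_apply_root, h]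

section

variable {P}

/-- The reflections in a strongly orthogonal set generate an elementary Abelian `2`-group. -/
lemma IsStronglyOrthogonalSet.exists_isElementaryAbelianTwo [P.IsCrystallographic] {S : Finset ι}
    (hS : P.IsStronglyOrthogonalSet S) :
    ∃ H : Subgroup P.weylGroup, IsElementaryAbelianTwo H ∧ 2 ^ S.card ≤ Nat.card H := by
  classical
  have hfix {i j : ι} (hi : i ∈ S) (hj : j ∈ S) (hij : i ≠ j) :
      weylGroup.ofIdx P i • P.root j = P.root j := by
    rw [ofIdx_smul_eq, root_coroot'_eq_pairing, (hS j hj i hi hij.symm).pairing_eq_zero, zero_smul,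
      sub_zero]
  set H := Subgroup.closure (weylGroup.ofIdx P '' S) with hH
  have hcomm : ∀ x ∈ H, ∀ y ∈ H, x * y = y * x := by
    intro x hx y hy
    refine Subgroup.closure_induction₂ (p := fun x y _ _ ↦ Commute x y) ?_ ?_ ?_ ?_ ?_ ?_ ?_ hx hy
    · rintro - - ⟨i, hi, rfl⟩ ⟨j, hj, rfl⟩
      rcases eq_or_ne i j with rfl | hij
      · exact Commute.refl _
      · exact mul_inv_eq_iff_eq_mul.mp (P.mul_ofIdx_mul_inv _ (hfix hi hj hij))
    · exact fun x _ ↦ Commute.one_left x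
    · exact fun x _ ↦ Commute.one_right x
    · exact fun x y z _ _ _ h1 h2 ↦ h1.mul_left h2
    · exact fun x y z _ _ _ h1 h2 ↦ h1.mul_right h2
    · exact fun x y _ _ h ↦ h.inv_left
    · exact fun x y _ _ h ↦ h.inv_right
  refine ⟨H, ⟨hcomm, fun x hx ↦ ?_⟩, ?_⟩
  · induction hx using Subgroup.closure_induction with
    | mem x hx =>
      obtain ⟨i, -, rfl⟩ := hx
      rw [sq, ofIdx_mul_self]
    | one => simp
    | mul x y hx hy hx' hy' =>
      rw [(show Commute x y from hcomm x hx y hy).mul_pow, hx', hy', one_mul]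
    | inv x hx hx' => rw [inv_pow, hx', inv_one]
  -- Each subset `T` of `S` yields an element of `H` negating exactly the roots of `S` in `T`,
  -- whence `2 ^ S.card` elements.
  · have hsign (T : Finset ι) : T ⊆ S → ∃ h ∈ H, ∀ j ∈ S,
        h • P.root j = if j ∈ T then -P.root j else P.root j := by
      induction T using Finset.induction_on with
      | empty => exact fun _ ↦ ⟨1, one_mem _, by simp⟩
      | insert a T ha ih =>
        intro hT
        obtain ⟨haS, hTS⟩ := Finset.insert_subset_iff.mp hT
        obtain ⟨h, hh, hsign⟩ := ih hTS
        refine ⟨weylGroup.ofIdx P a * h, mul_mem (Subgroup.subset_closure ⟨a, haS, rfl⟩) hh,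
          fun j hj ↦ ?_⟩
        rw [mul_smul, hsign j hj]
        rcases eq_or_ne a j with rfl | haj
        · simp [ha]
        · have hm : j ∈ insert a T ↔ j ∈ T := by simp [haj.symm]
          simp only [hm]
          split_ifs
          · rw [smul_neg, hfix haS hj haj]
          · exact hfix haS hj haj
    have hsign' (T : S.powerset) : ∃ h : H, ∀ j ∈ S,
        (h : P.weylGroup) • P.root j = if j ∈ T.1 then -P.root j else P.root j := by
      obtain ⟨h, hh, h'⟩ := hsign T (Finset.mem_powerset.mp T.2)
      exact ⟨⟨h, hh⟩, h'⟩
    choose F hF using hsign'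
    have := P.finite_weylGroup
    have hinj : Injective F := by
      intro T U h
      ext j
      by_cases hj : j ∈ S
      · have h1 := hF T j hj
        rw [h, hF U j hj] at h1
        have hne : -P.root j ≠ P.root j := fun h ↦ P.ne_zero j (eq_zero_of_neg_eq_self h)
        split_ifs at h1 with h2 h3 h3
        · simp [h2, h3]
        · exact absurd h1 hne
        · exact absurd h1.symm hne
        · simp [h2, h3]
      · exact iff_of_false (fun h ↦ hj (Finset.mem_powerset.mp T.2 h))
          fun h ↦ hj (Finset.mem_powerset.mp U.2 h)
    simpa only [Nat.card_eq_fintype_card, Fintype.card_coe, Finset.card_powerset] using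
      Nat.card_le_card_of_injective F hinj

end

lemma coroot'_smul_of_smul_root_eq_neg {w : P.weylGroup} {i : ι}
    (h : w • P.root i = -P.root i) (v : V) : P.coroot' i (w • v) = -P.coroot' i v := by
  have := Fintype.ofFinite ι
  have h1 := P.rootForm_mul_coroot' i (w • v)
  have h2 := P.rootForm_mul_coroot' i v
  rw [← P.rootForm_smul_smul w (P.root i) v, h, map_neg, LinearMap.neg_apply] at h2
  exact mul_left_cancel₀ (P.rootForm_pos (P.ne_zero i)).ne' (by linear_combination h1 + h2)

lemma ofIdx_mul_smul_eq_neg_iff {w : P.weylGroup} {i : ι} (h : w • P.root i = -P.root i) (v : V) :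
    (weylGroup.ofIdx P i * w) • v = -v ↔ w • v = -v ∧ P.coroot' i v = 0 := by
  rw [mul_smul, ofIdx_smul_eq, P.coroot'_smul_of_smul_root_eq_neg h]
  refine ⟨fun hv ↦ ?_, fun ⟨h1, h2⟩ ↦ by simp [h1, h2]⟩
  have h1 := congrArg (P.coroot' i) hv
  rw [map_sub, LinearMap.map_smul, P.coroot'_smul_of_smul_root_eq_neg h, map_neg, root_coroot'_eq_pairing,
    pairing_same, smul_eq_mul] at h1
  have h2 : P.coroot' i v = 0 := by linarith
  rw [h2] at hv
  exact ⟨by simpa using hv, h2⟩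

/-- The new eigenspace is the hyperplane of the old one cut out by `coroot' i`, which is nonzero
there because `root i` lies in it. -/
lemma finrank_eigenspace_ofIdx_mul_add_one {w : P.weylGroup} {i : ι}
    (h : w • P.root i = -P.root i) :
    finrank ℝ ((P.weylGroupToEnd (weylGroup.ofIdx P i * w)).eigenspace (-1)) + 1 =
      finrank ℝ ((P.weylGroupToEnd w).eigenspace (-1)) := by
  have := P.moduleFinite_weightSpace
  set E := (P.weylGroupToEnd w).eigenspace (-1) with hE
  let φ : Dual ℝ E := P.coroot' i ∘ₗ E.subtype
  have hφ : φ ≠ 0 := fun h0 ↦ by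
    have := LinearMap.congr_fun h0 ⟨P.root i, P.mem_eigenspace_weylGroupToEnd_neg_one.mpr h⟩
    simp [φ] at this
  have hmap : (P.weylGroupToEnd (weylGroup.ofIdx P i * w)).eigenspace (-1) =
      (LinearMap.ker φ).map E.subtype := by
    ext v
    rw [mem_eigenspace_weylGroupToEnd_neg_one, P.ofIdx_mul_smul_eq_neg_iff h,
      ← mem_eigenspace_weylGroupToEnd_neg_one]
    simp [φ, hE, and_comm]
  rw [hmap, Submodule.finrank_map_subtype_eq, Module.Dual.finrank_ker_add_one_of_ne_zero hφ]

/-- The `-1`-eigenspace of an involution in the Weyl group has a strongly orthogonal spanning set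
of roots. -/
lemma exists_isStronglyOrthogonalSet_card_eq [P.IsCrystallographic] {w : P.weylGroup}
    (hw : w * w = 1) :
    ∃ S : Finset ι, P.IsStronglyOrthogonalSet S ∧ (∀ i ∈ S, w • P.root i = -P.root i) ∧
      S.card = finrank ℝ ((P.weylGroupToEnd w).eigenspace (-1)) := by
  classical
  have := Fintype.ofFinite ι
  have := P.moduleFinite_weightSpace
  induction hn : finrank ℝ ((P.weylGroupToEnd w).eigenspace (-1)) generalizing w with
  | zero => exact ⟨∅, by simp [IsStronglyOrthogonalSet], by simp, rfl⟩
  | succ n ih =>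
    have hne : w ≠ 1 := by
      rintro rfl
      have : (P.weylGroupToEnd 1).eigenspace (-1) = ⊥ := by
        refine (Submodule.eq_bot_iff _).mpr fun v hv ↦ ?_
        rw [mem_eigenspace_weylGroupToEnd_neg_one, one_smul] at hv
        exact eq_zero_of_neg_eq_self hv.symm
      rw [this, finrank_bot] at hn
      omega
    -- Maximal length upgrades orthogonality to strong orthogonality.
    obtain ⟨i, hi⟩ := (Set.toFinite {i | w • P.root i = -P.root i}).exists_maximalFor
      (fun i ↦ P.RootForm (P.root i) (P.root i)) _ (P.exists_smul_root_eq_neg hw hne)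
    have hi0 : w • P.root i = -P.root i := hi.prop
    have hcomm : w * weylGroup.ofIdx P i = weylGroup.ofIdx P i * w := by
      have h1 : weylGroup.ofIdx P (P.reflectionPerm i i) = weylGroup.ofIdx P i :=
        P.ofIdx_eq_of_root_eq_smul (c := -1) (by simp)
      rw [← mul_inv_eq_iff_eq_mul, ← h1]
      nth_rw 1 [h1]
      exact P.mul_ofIdx_mul_inv w (by simpa using hi0)
    obtain ⟨S, hS, hSw, hcard⟩ := ih (w := weylGroup.ofIdx P i * w)
      (by rw [mul_assoc, ← mul_assoc w, hcomm, mul_assoc, hw, mul_one, ofIdx_mul_self])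
      (by have := P.finrank_eigenspace_ofIdx_mul_add_one hi0; omega)
    simp only [P.ofIdx_mul_smul_eq_neg_iff hi0, root_coroot'_eq_pairing] at hSw
    have hiS : i ∉ S := fun h ↦ by simpa using (hSw i h).2
    have hform {j : ι} (hj : j ∈ S) : P.RootForm (P.root i) (P.root j) = 0 := by
      have := P.rootForm_mul_coroot' i (P.root j)
      rw [root_coroot'_eq_pairing, (hSw j hj).2] at this
      linarith
    have hpos (j : ι) := P.rootForm_pos (P.ne_zero j)
    have hlong {k : ι} (hk : w • P.root k = -P.root k) :
        P.RootForm (P.root k) (P.root k) ≤ P.RootForm (P.root i) (P.root i) := by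
      by_contra! hlt
      exact hlt.not_ge (hi.2 hk hlt.le)
    have hso {j : ι} (hj : j ∈ S) : P.IsStronglyOrthogonal i j := by
      have h1 := hform hj
      refine ⟨⟨fun h ↦ ?_, fun h ↦ ?_⟩, fun ⟨k, hk⟩ ↦ ?_, fun ⟨k, hk⟩ ↦ ?_⟩
      · rw [h] at h1
        exact (hpos j).ne' h1
      · rw [h, map_neg, LinearMap.neg_apply, neg_eq_zero] at h1
        exact (hpos j).ne' h1
      -- A root `root i ± root j` would also be negated by `w`, and by orthogonality it would be
      -- strictly longer than `root i`.
      all_goals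
        have h2 := hlong (k := k) (by
          rw [hk]; simp only [smul_add, smul_sub, hi0, (hSw j hj).1]; abel)
        rw [hk] at h2
        simp only [map_add, map_sub, LinearMap.add_apply, LinearMap.sub_apply, h1,
          P.rootForm_comm (P.root j) (P.root i)] at h2
        linarith [hpos j]
    have hsymm {i j : ι} (h : P.IsStronglyOrthogonal i j) : P.IsStronglyOrthogonal j i :=
      ⟨⟨h.1.1.symm, fun h' ↦ h.1.2 (by rw [h', neg_neg])⟩, by rw [add_comm]; exact h.2.1,
        by rw [← P.neg_mem_range_root_iff, neg_sub]; exact h.2.2⟩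
    refine ⟨insert i S, ?_, ?_, by rw [Finset.card_insert_of_notMem hiS, hcard]⟩
    · intro j hj k hk hjk
      rcases Finset.mem_insert.mp hj with rfl | hj' <;>
        rcases Finset.mem_insert.mp hk with rfl | hk'
      · exact absurd rfl hjk
      · exact hso hk'
      · exact hsymm (hso hj')
      · exact hS j hj' k hk' hjk
    · simpa using ⟨hi0, fun j hj ↦ (hSw j hj).1⟩

lemma exists_card_le_two_pow_of_isElementaryAbelianTwo {H : Subgroup P.weylGroup}
    (hH : IsElementaryAbelianTwo H) :
    ∃ w : P.weylGroup, w * w = 1 ∧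
      Nat.card H ≤ 2 ^ finrank ℝ ((P.weylGroupToEnd w).eigenspace (-1)) := by
  have := P.moduleFinite_weightSpace
  have := P.finite_weylGroup
  obtain ⟨w, hw⟩ := End.exists_card_le_two_pow_finrank_eigenspace (P.weylGroupToEnd.comp H.subtype)
    (fun x y ↦ Subtype.ext (hH.1 x x.2 y y.2)) (fun x ↦ Subtype.ext (hH.2 x x.2))
    fun x y h ↦ Subtype.ext (P.weylGroup_ext fun v ↦ LinearMap.congr_fun h v)
  exact ⟨w, by rw [← sq]; exact hH.2 w w.2, hw⟩

end RootPairing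

theorem mainTheorem3 {ι V N : Type*} [Finite ι] [AddCommGroup V] [Module ℝ V]
    [AddCommGroup N] [Module ℝ N] (Φ : RootPairing ι ℝ V N)
    [Φ.IsRootSystem] [Φ.IsCrystallographic] [Φ.IsIrreducible] :
    ∃ r₂ : ℕ, HasTwoRank Φ.weylGroup r₂ ∧
      IsGreatest {n : ℕ | ∃ S : Finset ι, Φ.IsStronglyOrthogonalSet S ∧ S.card = n} r₂ ∧
      (r₂ = Module.finrank ℝ V ↔ ∃ w : Φ.weylGroup, ∀ v : V, w • v = -v) := by
  have := Φ.moduleFinite_weightSpace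
  set A := {n : ℕ | ∃ S : Finset ι, Φ.IsStronglyOrthogonalSet S ∧ S.card = n} with hA
  have hbdd : BddAbove A := ⟨Nat.card ι, by
    rintro - ⟨S, -, rfl⟩
    have := Fintype.ofFinite ι
    rw [Nat.card_eq_fintype_card]
    exact S.card_le_univ⟩
  have hgreat : IsGreatest A (sSup A) :=
    ⟨Nat.sSup_mem ⟨0, ∅, by simp [RootPairing.IsStronglyOrthogonalSet], rfl⟩ hbdd,
      fun n hn ↦ le_csSup hbdd hn⟩
  generalize sSup A = r at hgreat
  have hinv {w : Φ.weylGroup} (hw : w * w = 1) :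
      Module.finrank ℝ ((Φ.weylGroupToEnd w).eigenspace (-1)) ≤ r := by
    obtain ⟨S, hS, -, hcard⟩ := Φ.exists_isStronglyOrthogonalSet_card_eq hw
    exact hgreat.2 ⟨S, hS, hcard⟩
  obtain ⟨S, hS, hcard⟩ := hgreat.1
  obtain ⟨H, hH, hle⟩ := hS.exists_isElementaryAbelianTwo
  -- The `-1`-eigenspace of this `w` has dimension at least `r`; if `r` is the full rank, then `w =
  -- -1`.
  obtain ⟨w, hw, hwH⟩ := Φ.exists_card_le_two_pow_of_isElementaryAbelianTwo hH
  have hr : r ≤ Module.finrank ℝ ((Φ.weylGroupToEnd w).eigenspace (-1)) :=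
    (Nat.pow_le_pow_iff_right one_lt_two).mp (hcard ▸ hle.trans hwH)
  refine ⟨r, ⟨⟨H, hH, ?_⟩, ?_⟩, hgreat, fun h ↦ ?_, fun ⟨u, hu⟩ ↦ ?_⟩
  · exact le_antisymm (hwH.trans (Nat.pow_le_pow_right two_pos (hinv hw))) (hcard ▸ hle)
  · rintro - ⟨K, hK, rfl⟩
    obtain ⟨u, hu, huK⟩ := Φ.exists_card_le_two_pow_of_isElementaryAbelianTwo hK
    exact huK.trans (Nat.pow_le_pow_right two_pos (hinv hu))
  · have htop := Submodule.eq_top_of_finrank_eq (le_antisymm (Submodule.finrank_le _) (h ▸ hr))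
    exact ⟨w, fun v ↦ Φ.mem_eigenspace_weylGroupToEnd_neg_one.mp (htop ▸ Submodule.mem_top)⟩
  · have htop : (Φ.weylGroupToEnd u).eigenspace (-1) = ⊤ :=
      eq_top_iff.mpr fun v _ ↦ Φ.mem_eigenspace_weylGroupToEnd_neg_one.mpr (hu v)
    have h1 := hinv (w := u) (Φ.weylGroup_ext fun v ↦ by simp [mul_smul, hu])
    rw [htop, finrank_top] at h1
    exact le_antisymm (hr.trans (Submodule.finrank_le _)) h1
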